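/- For an $n\times n$ complex matrix $A=(a_{ij})$ let $\operatorname{per}A=\sum_{\sigma\in S_n}\prod_{i=1}^n a_{i\sigma(i)}$ be its permanent and let $\|A\|$ be its operator norm with respect to the Euclidean norm on $\mathbb C^n$ (its largest singular value). Then for all $n\times n$ complex matrices $A$ and $X$, $$|\operatorname{per}(A+X)-\operatorname{per}A|\le\sum_{k=1}^{n}\binom nk\,\|A\|^{n-k}\,\|X\|^{k}.$$ The bound is attained for $A=I$ and $X=xI$ with $x\ge 0$ real: in that case both sides are equal to $\sum_{k=1}^{n}\binom nk x^k$. -/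

import Mathlib

-- `‖A‖` for a complex matrix `A` is the operator norm induced by the Euclidean norm
-- on `ℂⁿ`, that is, the largest singular value of `A`.
open scoped Matrix.Norms.L2Operator

/-! Let `v` be the sum of `e_τ(1) ⊗ … ⊗ e_τ(n)` over all permutations `τ`, so `‖v‖² = n!`. Then `n!
· per A = ⟨v, A^{⊗n} v⟩`. More generally `|⟨v, (A₁ ⊗ … ⊗ Aₙ) v⟩| ≤ n! ∏ ‖Aᵢ‖`
(`Matrix.norm_mixedPermanent_le`), since the norm of a tensor product is at most the product of the
norms. Expanding `(A + X)^{⊗n}` over the set `S` of factors equal to `X`, the term `S = ∅` is `per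
A`; the others, grouped by `|S| = k`, give the bound. -/

/-- The action of a matrix on coordinate vectors is bounded by its `ℓ²` operator norm. -/
theorem Matrix.sum_norm_sq_mulVec_le {ι : Type*} [Fintype ι] [DecidableEq ι]
    (A : Matrix ι ι ℂ) (v : ι → ℂ) :
    ∑ a, ‖∑ b, A a b * v b‖ ^ 2 ≤ ‖A‖ ^ 2 * ∑ b, ‖v b‖ ^ 2 := by
  have h := Matrix.l2_opNorm_mulVec A (WithLp.toLp 2 v)
  have h2 := pow_le_pow_left₀ (norm_nonneg _) h 2
  rw [mul_pow, EuclideanSpace.norm_sq_eq, EuclideanSpace.norm_sq_eq] at h2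
  simpa [Matrix.mulVec, dotProduct] using h2

/-- The tensor product of matrices, acting on functions of several indices, has operator norm at
most the product of the operator norms. -/
theorem Matrix.sum_norm_sq_tensor_le {ι : Type*} [Fintype ι] [DecidableEq ι] {m : ℕ}
    (A : Fin m → Matrix ι ι ℂ) (v : (Fin m → ι) → ℂ) :
    ∑ f : Fin m → ι, ‖∑ g : Fin m → ι, (∏ i, A i (f i) (g i)) * v g‖ ^ 2 ≤
      (∏ i, ‖A i‖) ^ 2 * ∑ g, ‖v g‖ ^ 2 := by
  induction m with
  | zero => simp
  | succ m ih =>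
    have split {M : Type} [AddCommMonoid M] (F : (Fin (m + 1) → ι) → M) :
        ∑ f, F f = ∑ a, ∑ f : Fin m → ι, F (Fin.cons a f) := by
      rw [← (Fin.consEquiv fun _ => ι).sum_comp, Fintype.sum_prod_type]
      rfl
    simp only [split, Fin.prod_univ_succ, Fin.cons_zero, Fin.cons_succ]
    -- Apply `A 0` in the first index, leaving for each fixed `a` a vector in the other `m` indices,
    -- to which `ih` applies.
    calc ∑ a, ∑ f : Fin m → ι, ‖∑ b, ∑ g : Fin m → ι,
            A 0 a b * (∏ i : Fin m, A i.succ (f i) (g i)) * v (Fin.cons b g)‖ ^ 2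
        = ∑ a, ∑ f : Fin m → ι, ‖∑ g : Fin m → ι,
            (∏ i : Fin m, A i.succ (f i) (g i)) * ∑ b, A 0 a b * v (Fin.cons b g)‖ ^ 2 := by
          refine Finset.sum_congr rfl fun a _ => Finset.sum_congr rfl fun f _ => ?_
          rw [Finset.sum_comm]
          simp only [Finset.mul_sum]
          congr 2
          refine Finset.sum_congr rfl fun g _ => Finset.sum_congr rfl fun b _ => ?_
          ring
      _ ≤ ∑ a, (∏ i : Fin m, ‖A i.succ‖) ^ 2 *
            ∑ g : Fin m → ι, ‖∑ b, A 0 a b * v (Fin.cons b g)‖ ^ 2 :=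
          Finset.sum_le_sum fun a _ =>
            ih (fun i => A i.succ) fun g => ∑ b, A 0 a b * v (Fin.cons b g)
      _ = (∏ i : Fin m, ‖A i.succ‖) ^ 2 *
            ∑ g : Fin m → ι, ∑ a, ‖∑ b, A 0 a b * v (Fin.cons b g)‖ ^ 2 := by
          rw [← Finset.mul_sum, Finset.sum_comm]
      _ ≤ (∏ i : Fin m, ‖A i.succ‖) ^ 2 *
            ∑ g : Fin m → ι, ‖A 0‖ ^ 2 * ∑ b, ‖v (Fin.cons b g)‖ ^ 2 := by
          gcongr with g
          exact (A 0).sum_norm_sq_mulVec_le fun b => v (Fin.cons b g)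
      _ = (‖A 0‖ * ∏ i : Fin m, ‖A i.succ‖) ^ 2 *
            ∑ b, ∑ g : Fin m → ι, ‖v (Fin.cons b g)‖ ^ 2 := by
          rw [← Finset.mul_sum, Finset.sum_comm]
          ring

/-- The mixed permanent (up to the factor `n !`) is bounded by the product of the norms. -/
theorem Matrix.norm_mixedPermanent_le {n : ℕ} (A : Fin n → Matrix (Fin n) (Fin n) ℂ) :
    ‖∑ σ : Equiv.Perm (Fin n), ∑ τ : Equiv.Perm (Fin n), ∏ i, A i (σ i) (τ i)‖ ≤
      (n.factorial : ℝ) * ∏ i, ‖A i‖ := by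
  classical
  have coe_inj : Function.Injective fun τ : Equiv.Perm (Fin n) => (τ : Fin n → Fin n) :=
    DFunLike.coe_injective
  let e : Equiv.Perm (Fin n) ↪ (Fin n → Fin n) := ⟨_, coe_inj⟩
  let v : (Fin n → Fin n) → ℂ := fun g => if g ∈ Finset.univ.map e then 1 else 0
  have hv : ∑ g, ‖v g‖ ^ 2 = (n.factorial : ℝ) := by
    have : ∀ g, ‖v g‖ ^ 2 = if g ∈ Finset.univ.map e then (1 : ℝ) else 0 := fun g => by
      by_cases hg : g ∈ Finset.univ.map e <;> simp only [v, hg, if_true, if_false] <;> simp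
    simp only [this]
    rw [Finset.sum_ite_mem, Finset.univ_inter, Finset.sum_const, Finset.card_map,
      Finset.card_univ, Fintype.card_perm, Fintype.card_fin, nsmul_eq_mul, mul_one]
  have hsum (f : Fin n → Fin n) : ∑ g, (∏ i, A i (f i) (g i)) * v g =
      ∑ τ : Equiv.Perm (Fin n), ∏ i, A i (f i) (τ i) := by
    simp only [v, mul_ite, mul_one, mul_zero]
    rw [Finset.sum_ite_mem, Finset.univ_inter, Finset.sum_map]
    rfl
  have key := Matrix.sum_norm_sq_tensor_le A v
  simp only [hsum, hv] at key
  have hperm : ∑ σ : Equiv.Perm (Fin n), ‖∑ τ : Equiv.Perm (Fin n), ∏ i, A i (σ i) (τ i)‖ ^ 2 ≤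
      (∏ i, ‖A i‖) ^ 2 * n.factorial := by
    -- Only the coordinates `f` that are permutations are kept.
    refine le_trans ?_ key
    refine (Finset.sum_map Finset.univ e fun f : Fin n → Fin n =>
      ‖∑ τ : Equiv.Perm (Fin n), ∏ i, A i (f i) (τ i)‖ ^ 2).symm.trans_le ?_
    exact Finset.sum_le_sum_of_subset_of_nonneg (Finset.subset_univ _) fun _ _ _ => by positivity
  -- Cauchy–Schwarz over the `n!` permutations `σ` supplies the second factor `√n!`.
  refine (norm_sum_le _ _).trans (le_of_sq_le_sq ?_ (by positivity))
  calc (∑ σ : Equiv.Perm (Fin n), ‖∑ τ : Equiv.Perm (Fin n), ∏ i, A i (σ i) (τ i)‖) ^ 2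
      ≤ (n.factorial : ℝ) *
          ∑ σ : Equiv.Perm (Fin n), ‖∑ τ : Equiv.Perm (Fin n), ∏ i, A i (σ i) (τ i)‖ ^ 2 := by
        simpa [Fintype.card_perm] using sq_sum_le_card_mul_sum_sq (s := Finset.univ)
          (f := fun σ : Equiv.Perm (Fin n) =>
            ‖∑ τ : Equiv.Perm (Fin n), ∏ i, A i (σ i) (τ i)‖)
    _ ≤ n.factorial * ((∏ i, ‖A i‖) ^ 2 * n.factorial) := by gcongr
    _ = (n.factorial * ∏ i, ‖A i‖) ^ 2 := by ring

/-- For each fixed `τ`, reindexing the rows turns the sum over `σ` into the permanent. -/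
theorem Matrix.factorial_mul_permanent {R : Type*} [CommRing R] {n : ℕ}
    (A : Matrix (Fin n) (Fin n) R) :
    (n.factorial : R) * A.permanent =
      ∑ σ : Equiv.Perm (Fin n), ∑ τ : Equiv.Perm (Fin n), ∏ i, A (σ i) (τ i) := by
  rw [Finset.sum_comm]
  have h (τ : Equiv.Perm (Fin n)) :
      ∑ σ : Equiv.Perm (Fin n), ∏ i, A (σ i) (τ i) = A.permanent := by
    have := A.permanent_permute_rows τ
    simpa [Matrix.permanent] using this
  simp [h, Fintype.card_perm]

theorem Matrix.norm_permanent_add_sub_le {n : ℕ} (A X : Matrix (Fin n) (Fin n) ℂ) :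
    ‖(A + X).permanent - A.permanent‖ ≤
      ∑ k ∈ Finset.Icc 1 n, (n.choose k : ℝ) * ‖A‖ ^ (n - k) * ‖X‖ ^ k := by
  classical
  let B (S : Finset (Fin n)) (i : Fin n) : Matrix (Fin n) (Fin n) ℂ := if i ∈ S then X else A
  let P (S : Finset (Fin n)) : ℂ :=
    ∑ σ : Equiv.Perm (Fin n), ∑ τ : Equiv.Perm (Fin n), ∏ i, B S i (σ i) (τ i)
  have hadd : (n.factorial : ℂ) * (A + X).permanent = ∑ S, P S := by
    rw [Matrix.factorial_mul_permanent]
    refine Eq.trans (Finset.sum_congr rfl fun σ _ => ?_) Finset.sum_comm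
    refine Eq.trans (Finset.sum_congr rfl fun τ _ => ?_) Finset.sum_comm
    simp only [Matrix.add_apply, add_comm (A _ _)]
    rw [Finset.prod_add, Finset.powerset_univ]
    refine Finset.sum_congr rfl fun S _ => ?_
    have (i : Fin n) : B S i (σ i) (τ i) = if i ∈ S then X (σ i) (τ i) else A (σ i) (τ i) := by
      simp only [B]; split_ifs <;> rfl
    simp only [this]
    rw [Finset.prod_ite]
    congr 2 <;> ext <;> simp
  have hempty : (n.factorial : ℂ) * A.permanent = P ∅ := by
    rw [Matrix.factorial_mul_permanent]
    simp [P, B]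
  have hP (S : Finset (Fin n)) :
      ‖P S‖ ≤ n.factorial * (‖A‖ ^ (n - S.card) * ‖X‖ ^ S.card) := by
    refine (Matrix.norm_mixedPermanent_le (B S)).trans_eq ?_
    have (i : Fin n) : ‖B S i‖ = if i ∈ S then ‖X‖ else ‖A‖ := by
      simp only [B]; split_ifs <;> rfl
    simp only [this]
    rw [Finset.prod_ite, Finset.prod_const, Finset.prod_const, Finset.filter_univ_mem,
      Finset.filter_not, Finset.filter_univ_mem, Finset.card_univ_sdiff, Fintype.card_fin,
      mul_comm (‖X‖ ^ _)]
  have hdiff : (n.factorial : ℂ) * ((A + X).permanent - A.permanent) =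
      ∑ S ∈ Finset.univ.erase ∅, P S := by
    rw [mul_sub, hadd, hempty, ← Finset.add_sum_erase _ _ (Finset.mem_univ ∅),
      add_sub_cancel_left]
  have hcard : ∑ S ∈ (Finset.univ : Finset (Finset (Fin n))).erase ∅,
        ‖A‖ ^ (n - S.card) * ‖X‖ ^ S.card =
      ∑ k ∈ Finset.Icc 1 n, (n.choose k : ℝ) * ‖A‖ ^ (n - k) * ‖X‖ ^ k := by
    have h := Finset.sum_powerset_apply_card (x := (Finset.univ : Finset (Fin n)))
      fun k => ‖A‖ ^ (n - k) * ‖X‖ ^ k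
    rw [Finset.powerset_univ, ← Finset.add_sum_erase _ _ (Finset.mem_univ ∅), Finset.card_univ,
      Fintype.card_fin, Finset.sum_range_succ', add_comm] at h
    -- The term `S = ∅` cancels against `k = 0`.
    simp only [Finset.card_empty, Nat.choose_zero_right, one_smul, add_left_inj] at h
    rw [h, Finset.range_eq_Ico, Finset.sum_Ico_add' (fun k => n.choose k • (‖A‖ ^ (n - k) *
      ‖X‖ ^ k)) 0 n 1]
    simp only [nsmul_eq_mul, mul_assoc]
    rfl
  have hn : (0 : ℝ) < n.factorial := by exact_mod_cast n.factorial_pos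
  refine le_of_mul_le_mul_left ?_ hn
  calc (n.factorial : ℝ) * ‖(A + X).permanent - A.permanent‖
      = ‖∑ S ∈ Finset.univ.erase ∅, P S‖ := by rw [← hdiff, norm_mul, Complex.norm_natCast]
    _ ≤ ∑ S ∈ Finset.univ.erase ∅, n.factorial * (‖A‖ ^ (n - S.card) * ‖X‖ ^ S.card) :=
        norm_sum_le_of_le _ fun S _ => hP S
    _ = _ := by rw [← Finset.mul_sum, hcard]

theorem corollary2p1 (n : ℕ) :
    (∀ A X : Matrix (Fin n) (Fin n) ℂ,
      ‖(A + X).permanent - A.permanent‖ ≤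
        ∑ k ∈ Finset.Icc 1 n, (n.choose k : ℝ) * ‖A‖ ^ (n - k) * ‖X‖ ^ k) ∧
    (∀ x : ℝ, 0 ≤ x → ∀ A X : Matrix (Fin n) (Fin n) ℂ, A = 1 → X = (x : ℂ) • 1 →
      ‖(A + X).permanent - A.permanent‖ =
          ∑ k ∈ Finset.Icc 1 n, (n.choose k : ℝ) * ‖A‖ ^ (n - k) * ‖X‖ ^ k ∧
        ∑ k ∈ Finset.Icc 1 n, (n.choose k : ℝ) * ‖A‖ ^ (n - k) * ‖X‖ ^ k =
          ∑ k ∈ Finset.Icc 1 n, (n.choose k : ℝ) * x ^ k) := by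
  refine ⟨Matrix.norm_permanent_add_sub_le, ?_⟩
  rintro x hx _ _ rfl rfl
  have hright : ∑ k ∈ Finset.Icc 1 n, (n.choose k : ℝ) *
        ‖(1 : Matrix (Fin n) (Fin n) ℂ)‖ ^ (n - k) *
        ‖(x : ℂ) • (1 : Matrix (Fin n) (Fin n) ℂ)‖ ^ k =
      ∑ k ∈ Finset.Icc 1 n, (n.choose k : ℝ) * x ^ k := by
    -- For `n = 0` the identity matrix has norm `0`, not `1`, but the sums are empty.
    rcases Nat.eq_zero_or_pos n with rfl | hn
    · simp
    · have : Nonempty (Fin n) := ⟨⟨0, hn⟩⟩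
      have h1 : ‖(1 : Matrix (Fin n) (Fin n) ℂ)‖ = 1 := CStarRing.norm_one
      simp [norm_smul, h1, abs_of_nonneg hx]
  refine ⟨?_, hright⟩
  rw [hright]
  have hdiag : (1 : Matrix (Fin n) (Fin n) ℂ) + (x : ℂ) • 1 =
      Matrix.diagonal fun _ => ((1 + x : ℝ) : ℂ) := by
    ext i j
    by_cases h : i = j <;> simp [h]
  have hpow : (1 + x) ^ n - 1 = ∑ k ∈ Finset.Icc 1 n, (n.choose k : ℝ) * x ^ k := by
    rw [add_comm, add_pow, Finset.sum_range_succ', Finset.range_eq_Ico,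
      Finset.sum_Ico_add' (fun k => x ^ k * 1 ^ (n - k) * (n.choose k : ℝ)) 0 n 1]
    simp only [one_pow, mul_one, pow_zero, Nat.choose_zero_right, Nat.cast_one,
      add_sub_cancel_right]
    exact Finset.sum_congr rfl fun k _ => mul_comm _ _
  have hnonneg : 0 ≤ ∑ k ∈ Finset.Icc 1 n, (n.choose k : ℝ) * x ^ k :=
    Finset.sum_nonneg fun k _ => by positivity
  rw [hdiag, Matrix.permanent_diagonal, Matrix.permanent_one, Finset.prod_const,
    Finset.card_univ, Fintype.card_fin, ← Complex.ofReal_pow, ← Complex.ofReal_one,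
    ← Complex.ofReal_sub, Complex.norm_real, hpow, Real.norm_of_nonneg hnonneg]
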